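/- Let $n\in\mathbb{N}$ and let $p_1,\dots,p_n>0$ be real numbers (strengths, not necessarily summing to $1$). The gladiator chain is the Markov chain on the set $S_n$ of permutations of $[n]=\{1,\dots,n\}$ in which a state $\pi$ assigns to each gladiator $i$ its rank $\pi(i)$, and which moves as follows: choose $k\in[n-1]$ uniformly at random and let $i=\pi^{-1}(k)$ and $j=\pi^{-1}(k+1)$; with probability $\frac{p_j}{p_i+p_j}$ the gladiators $i$ and $j$ exchange their ranks, and otherwise the ranking is unchanged (if $n\le 1$, the chain stays put). This chain has a unique stationary distribution, and for $\pi$ drawn from it and all $j\in[n]$, \[ \mathbb{E}\Biggl[\,\sum_{i\colon \pi(i)>\pi(j)}\max\{p_i-p_j,\,0\}\Biggr]\le p_j . \] -/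

import Mathlib

open scoped BigOperators Matrix

noncomputable section

/-- The rank with (zero-based) index `k`, the better of the two adjacent ranks `k`, `k + 1`. -/
def upperRank {n : ℕ} (k : Fin (n - 1)) : Fin n := ⟨k.val, by omega⟩

/-- The rank with (zero-based) index `k + 1`. -/
def lowerRank {n : ℕ} (k : Fin (n - 1)) : Fin n := ⟨k.val + 1, by omega⟩

/-- The ranking obtained from `π` (a map from gladiators to ranks) when the gladiators at the
adjacent ranks `k` and `k + 1` exchange their ranks. -/
def exchangeAt {n : ℕ} (k : Fin (n - 1)) (π : Equiv.Perm (Fin n)) : Equiv.Perm (Fin n) :=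
  π.trans (Equiv.swap (upperRank k) (lowerRank k))

/-- The probability of moving from the ranking `π` to the ranking `σ` through a fight between the
gladiator `i` at rank `k` and the gladiator `j` at rank `k + 1`: gladiator `j` wins with
probability `p j / (p i + p j)` and then the two exchange their ranks; otherwise `i` wins and
the ranking is unchanged. -/
def fightProb {n : ℕ} (p : Fin n → ℝ) (k : Fin (n - 1)) (π σ : Equiv.Perm (Fin n)) : ℝ :=
  let i := π.symm (upperRank k)
  let j := π.symm (lowerRank k)
  (if σ = exchangeAt k π then p j / (p i + p j) else 0) + (if σ = π then p i / (p i + p j) else 0)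

/-- The transition matrix of the gladiator chain with strengths `p`: the pair of adjacent ranks
`k`, `k + 1` that fights is uniform among the `n - 1` such pairs. If there is no such pair
(`n ≤ 1`) the chain stays put. -/
def gladiatorChain {n : ℕ} (p : Fin n → ℝ) :
    Matrix (Equiv.Perm (Fin n)) (Equiv.Perm (Fin n)) ℝ :=
  Matrix.of fun π σ =>
    if n ≤ 1 then (if σ = π then 1 else 0)
    else ∑ k : Fin (n - 1), (1 / ((n : ℝ) - 1)) * fightProb p k π σ

/-- `μ` is a stationary distribution of the Markov chain with transition matrix `P` on a finite
state space: a probability vector with `μ P = μ`. -/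
def IsStationaryDistribution {S : Type*} [Fintype S] (P : Matrix S S ℝ) (μ : S → ℝ) : Prop :=
  μ ∈ stdSimplex ℝ S ∧ μ ᵥ* P = μ

/-- The expectation of `f` under the probability vector `μ` on a finite set. -/
def expectation {S : Type*} [Fintype S] (μ f : S → ℝ) : ℝ := ∑ s, μ s * f s

/-- The total excess strength, over gladiator `j`, of the stronger gladiators that are ranked
below `j` in the ranking `π`. -/
def excessBelow {n : ℕ} (p : Fin n → ℝ) (j : Fin n) (π : Equiv.Perm (Fin n)) : ℝ :=
  ∑ i with π j < π i, max (p i - p j) 0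

end

open Finset Equiv

/-! The chain is reversible with respect to the product weight `w = rankingWeight p`, and adjacent
exchanges connect all rankings, so normalized `w` is the only stationary distribution. Fix `c` and
let `A` be the set of strictly stronger gladiators. With `i` ranging over members of `A` below `c`,
the bound becomes `∑ w π * p i ≤ ∑ w π * p c + p c * ∑ w π`, the first two sums being over pairs
`(π, i)`. Let `a` be the best ranked member of `A` below `c`. Single terms cannot be compared, so
`(π, i)` is grouped with its image under the involution `exchangeWithNext`, which interchanges the
roles of `a` and `i`. The two terms together are bounded after `c` is moved down past the next
member of `A` (`rankingWeight_pair_le`). This move, `passNext`, is injective, and its image lies in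
the same pairs together with the pairs `(π, c)`, which supply the last sum. -/

/-- The unnormalized stationary weight of the ranking `π`. -/
def rankingWeight {n : ℕ} (p : Fin n → ℝ) (π : Perm (Fin n)) : ℝ :=
  ∏ i, p i ^ ((π i).rev : ℕ)

/-- `T` is the whole state space as soon as it is nonempty and closed under possible moves. -/
def IsIrreducibleChain {S : Type*} (P : Matrix S S ℝ) : Prop :=
  ∀ T : Set S, T.Nonempty → (∀ s ∈ T, ∀ t, 0 < P s t → t ∈ T) → ∀ s, s ∈ T

/-! ### Finite reversible chains -/

theorem vecMul_eq_of_detailed_balance {S : Type*} [Fintype S] {P : Matrix S S ℝ} {w : S → ℝ}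
    (row : ∀ s, ∑ t, P s t = 1) (bal : ∀ s t, w s * P s t = w t * P t s) : w ᵥ* P = w := by
  ext t
  simp only [Matrix.vecMul, dotProduct]
  simp_rw [fun s => bal s t, ← Finset.mul_sum, row, mul_one]

theorem isStationaryDistribution_normalize {S : Type*} [Fintype S] [Nonempty S]
    {P : Matrix S S ℝ} {w : S → ℝ} (hw : ∀ s, 0 < w s)
    (row : ∀ s, ∑ t, P s t = 1) (bal : ∀ s t, w s * P s t = w t * P t s) :
    IsStationaryDistribution P (fun s => w s / ∑ t, w t) := by
  have hZ : 0 < ∑ t, w t := Finset.sum_pos (fun s _ => hw s) univ_nonempty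
  refine ⟨⟨fun s => (div_pos (hw s) hZ).le, ?_⟩, ?_⟩
  · rw [← Finset.sum_div, div_self hZ.ne']
  · refine vecMul_eq_of_detailed_balance row fun s t => ?_
    rw [div_mul_eq_mul_div, bal, div_mul_eq_mul_div]

/-- A function that is harmonic for an irreducible chain is constant. -/
theorem eq_of_harmonic {S : Type*} [Fintype S] {P : Matrix S S ℝ}
    (nonneg : ∀ s t, 0 ≤ P s t) (row : ∀ s, ∑ t, P s t = 1) (irr : IsIrreducibleChain P)
    {h : S → ℝ} (harm : ∀ s, ∑ t, P s t * h t = h s) (s t : S) : h s = h t := by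
  obtain ⟨m, -, hm⟩ := exists_max_image (univ : Finset S) h ⟨s, mem_univ s⟩
  -- Maximum principle: the set where `h` is maximal is closed under possible moves.
  have key : ∀ u, u ∈ {u | h u = h m} := by
    refine irr _ ⟨m, rfl⟩ fun u hu v hv => ?_
    change h u = h m at hu
    change h v = h m
    have hsum : ∑ x, P u x * (h m - h x) = 0 := by
      simp_rw [mul_sub, Finset.sum_sub_distrib, ← Finset.sum_mul, row, harm, hu]
      ring
    have := (Finset.sum_eq_zero_iff_of_nonneg fun x _ =>
      mul_nonneg (nonneg u x) (sub_nonneg.2 (hm x (mem_univ x)))).1 hsum v (mem_univ v)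
    rcases mul_eq_zero.1 this with h0 | h0
    · exact absurd h0 hv.ne'
    · linarith
  rw [key s, key t]

/-- By detailed balance the density `μ / w` is harmonic, hence constant. -/
theorem IsStationaryDistribution.eq_normalize {S : Type*} [Fintype S]
    {P : Matrix S S ℝ} {w μ : S → ℝ} (hw : ∀ s, 0 < w s) (nonneg : ∀ s t, 0 ≤ P s t)
    (row : ∀ s, ∑ t, P s t = 1) (bal : ∀ s t, w s * P s t = w t * P t s)
    (irr : IsIrreducibleChain P) (hμ : IsStationaryDistribution P μ) :
    μ = fun s => w s / ∑ t, w t := by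
  have harm : ∀ s, ∑ t, P s t * (μ t / w t) = μ s / w s := by
    intro s
    have h1 : ∑ t, μ t * P t s = μ s := by simpa [Matrix.vecMul, dotProduct] using congrFun hμ.2 s
    rw [← h1, Finset.sum_div]
    refine Finset.sum_congr rfl fun t _ => ?_
    have := bal s t
    have h1 := (hw s).ne'
    have h2 := (hw t).ne'
    field_simp
    linear_combination μ t * this
  ext s
  have hc : ∀ t, μ t = μ s / w s * w t := fun t => by
    rw [eq_of_harmonic nonneg row irr harm s t, div_mul_cancel₀ _ (hw t).ne']
  have h1 : μ s / w s * ∑ t, w t = 1 := by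
    rw [← hμ.1.2, Finset.mul_sum]
    exact Finset.sum_congr rfl fun t _ => (hc t).symm
  have hZ : ∑ t, w t ≠ 0 := right_ne_zero_of_mul_eq_one h1
  rw [eq_div_iff hZ, ← mul_one (w s), ← h1]
  have := (hw s).ne'
  field_simp

/-! ### Reversibility and irreducibility of the gladiator chain -/

section Gladiator

variable {n : ℕ} {p : Fin n → ℝ}

theorem rankingWeight_pos (hp : ∀ i, 0 < p i) (π : Perm (Fin n)) : 0 < rankingWeight p π :=
  Finset.prod_pos fun i _ => pow_pos (hp i) _

/-- Exchanging the ranks of `x` and `y` only affects two factors of the weight. -/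
theorem rankingWeight_split_two (p : Fin n → ℝ) (π : Perm (Fin n)) {x y : Fin n} (hxy : x ≠ y)
    (hp : ∀ i, 0 < p i) :
    ∃ R, 0 < R ∧ rankingWeight p π = R * (p x ^ ((π x).rev : ℕ) * p y ^ ((π y).rev : ℕ)) ∧
      rankingWeight p (π * swap x y) = R * (p x ^ ((π y).rev : ℕ) * p y ^ ((π x).rev : ℕ)) := by
  have hy : y ∈ univ.erase x := by simp [hxy.symm]
  refine ⟨∏ i ∈ (univ.erase x).erase y, p i ^ ((π i).rev : ℕ),
    Finset.prod_pos fun i _ => pow_pos (hp i) _, ?_, ?_⟩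
  · rw [rankingWeight, ← mul_prod_erase univ _ (mem_univ x), ← mul_prod_erase _ _ hy]
    ring
  · rw [rankingWeight, ← mul_prod_erase univ _ (mem_univ x), ← mul_prod_erase _ _ hy,
      Finset.prod_congr rfl (g := fun i => p i ^ ((π i).rev : ℕ))]
    · simp only [Perm.mul_apply, swap_apply_left, swap_apply_right]
      ring
    · intro i hi
      simp only [mem_erase] at hi
      rw [Perm.mul_apply, swap_apply_of_ne_of_ne hi.2.1 hi.1]

theorem upperRank_ne_lowerRank (k : Fin (n - 1)) : upperRank k ≠ lowerRank k := by
  simp [upperRank, lowerRank]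

theorem exchangeAt_eq_mul_swap (k : Fin (n - 1)) (π : Perm (Fin n)) :
    exchangeAt k π = π * swap (π.symm (upperRank k)) (π.symm (lowerRank k)) := by
  rw [mul_swap_eq_swap_mul, apply_symm_apply, apply_symm_apply]
  rfl

theorem exchangeAt_ne (k : Fin (n - 1)) (π : Perm (Fin n)) : exchangeAt k π ≠ π := by
  intro h
  have := congrArg (fun σ : Perm (Fin n) => σ (π.symm (upperRank k))) h
  simp only [exchangeAt, Equiv.trans_apply, apply_symm_apply, swap_apply_left] at this
  exact upperRank_ne_lowerRank k this.symm

theorem exchangeAt_exchangeAt (k : Fin (n - 1)) (π : Perm (Fin n)) :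
    exchangeAt k (exchangeAt k π) = π := by
  ext i
  simp [exchangeAt]

/-- The exponents at adjacent ranks differ by one, so the exchange trades one factor of the upper
gladiator's strength for one of the lower's. -/
theorem rankingWeight_exchangeAt (hp : ∀ i, 0 < p i) (k : Fin (n - 1)) (π : Perm (Fin n)) :
    rankingWeight p π * p (π.symm (lowerRank k)) =
      rankingWeight p (exchangeAt k π) * p (π.symm (upperRank k)) := by
  obtain ⟨R, -, h1, h2⟩ := rankingWeight_split_two p π
    (π.symm.injective.ne (upperRank_ne_lowerRank k)) hp
  rw [exchangeAt_eq_mul_swap, h1, h2, apply_symm_apply, apply_symm_apply]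
  have : ((upperRank k).rev : ℕ) = (lowerRank k).rev + 1 := by
    simp only [Fin.val_rev, upperRank, lowerRank]
    omega
  rw [this]
  ring

theorem fightProb_balance (hp : ∀ i, 0 < p i) (k : Fin (n - 1)) (π σ : Perm (Fin n)) :
    rankingWeight p π * fightProb p k π σ = rankingWeight p σ * fightProb p k σ π := by
  by_cases h1 : σ = π
  · rw [h1]
  by_cases h2 : σ = exchangeAt k π
  · subst h2
    have hu : (exchangeAt k π).symm (upperRank k) = π.symm (lowerRank k) := by simp [exchangeAt]
    have hl : (exchangeAt k π).symm (lowerRank k) = π.symm (upperRank k) := by simp [exchangeAt]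
    simp only [fightProb, hu, hl, exchangeAt_exchangeAt, exchangeAt_ne,
      (exchangeAt_ne k π).symm, if_true, if_false, add_zero]
    rw [← mul_div_assoc, rankingWeight_exchangeAt hp, mul_div_assoc,
      add_comm (p (π.symm (upperRank k)))]
  · have h3 : π ≠ exchangeAt k σ := fun h => h2 (by rw [h, exchangeAt_exchangeAt])
    simp [fightProb, h1, h2, h3, Ne.symm h1]

theorem fightProb_nonneg (hp : ∀ i, 0 < p i) (k : Fin (n - 1)) (π σ : Perm (Fin n)) :
    0 ≤ fightProb p k π σ := by
  have h : ∀ i j, 0 ≤ p i / (p j + p i) := fun i j =>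
    (div_pos (hp i) (add_pos (hp j) (hp i))).le
  have h' : ∀ i j, 0 ≤ p i / (p i + p j) := fun i j =>
    (div_pos (hp i) (add_pos (hp i) (hp j))).le
  unfold fightProb
  refine add_nonneg ?_ ?_ <;> split_ifs <;> first | exact le_rfl | exact h _ _ | exact h' _ _

theorem fightProb_exchangeAt_pos (hp : ∀ i, 0 < p i) (k : Fin (n - 1)) (π : Perm (Fin n)) :
    0 < fightProb p k π (exchangeAt k π) := by
  simp only [fightProb, exchangeAt_ne, if_true, if_false, add_zero]
  exact div_pos (hp _) (add_pos (hp _) (hp _))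

theorem sum_fightProb (hp : ∀ i, 0 < p i) (k : Fin (n - 1)) (π : Perm (Fin n)) :
    ∑ σ, fightProb p k π σ = 1 := by
  simp only [fightProb, Finset.sum_add_distrib, Finset.sum_ite_eq', mem_univ, if_true]
  rw [← add_div, add_comm (p (π.symm (lowerRank k)))]
  exact div_self (add_pos (hp _) (hp _)).ne'

theorem sum_gladiatorChain (hp : ∀ i, 0 < p i) (π : Perm (Fin n)) :
    ∑ σ, gladiatorChain p π σ = 1 := by
  simp only [gladiatorChain, Matrix.of_apply]
  split_ifs with hn
  · simp
  · rw [Finset.sum_comm]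
    simp_rw [← Finset.mul_sum, sum_fightProb hp]
    have h : (1 : ℝ) < n := by exact_mod_cast not_le.1 hn
    rw [Finset.sum_const, card_univ, Fintype.card_fin, nsmul_eq_mul, mul_one,
      Nat.cast_sub (not_le.1 hn).le, Nat.cast_one]
    exact one_div_mul_cancel (sub_pos.2 h).ne'

theorem gladiatorChain_nonneg (hp : ∀ i, 0 < p i) (π σ : Perm (Fin n)) :
    0 ≤ gladiatorChain p π σ := by
  simp only [gladiatorChain, Matrix.of_apply]
  split_ifs with hn
  · exact zero_le_one
  · exact le_rfl
  · have h : (1 : ℝ) < n := by exact_mod_cast not_le.1 hn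
    exact Finset.sum_nonneg fun k _ =>
      mul_nonneg (one_div_pos.2 (sub_pos.2 h)).le (fightProb_nonneg hp k π σ)

theorem gladiatorChain_balance (hp : ∀ i, 0 < p i) (π σ : Perm (Fin n)) :
    rankingWeight p π * gladiatorChain p π σ = rankingWeight p σ * gladiatorChain p σ π := by
  simp only [gladiatorChain, Matrix.of_apply]
  split_ifs with hn h1 h2 h2
  · rw [h1]
  · exact absurd h1.symm h2
  · exact absurd h2.symm h1
  · simp
  · rw [Finset.mul_sum, Finset.mul_sum]
    refine Finset.sum_congr rfl fun k _ => ?_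
    rw [mul_left_comm, fightProb_balance hp, mul_left_comm]

theorem gladiatorChain_exchangeAt_pos (hp : ∀ i, 0 < p i) (k : Fin (n - 1)) (π : Perm (Fin n)) :
    0 < gladiatorChain p π (exchangeAt k π) := by
  have hn : ¬ n ≤ 1 := by have := k.2; omega
  have h : (1 : ℝ) < n := by exact_mod_cast not_le.1 hn
  have h' : 0 < 1 / ((n : ℝ) - 1) := one_div_pos.2 (sub_pos.2 h)
  simp only [gladiatorChain, Matrix.of_apply, if_neg hn]
  exact Finset.sum_pos' (fun l _ => mul_nonneg h'.le (fightProb_nonneg hp l π _))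
    ⟨k, mem_univ k, mul_pos h' (fightProb_exchangeAt_pos hp k π)⟩

/-- Adjacent transpositions generate the symmetric group. -/
theorem forall_mem_of_exchangeAt_mem {T : Set (Perm (Fin n))} (hT : T.Nonempty)
    (h : ∀ π ∈ T, ∀ k, exchangeAt k π ∈ T) (π : Perm (Fin n)) : π ∈ T := by
  obtain ⟨τ, hτ⟩ := hT
  cases n with
  | zero => rwa [Subsingleton.elim π τ]
  | succ m =>
    suffices H : ∀ g : Perm (Fin (m + 1)), ∀ ρ ∈ T, g * ρ ∈ T by
      simpa using H (π * τ⁻¹) τ hτ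
    intro g
    have hg : g ∈ Submonoid.closure
        (Set.range fun i : Fin m ↦ swap i.castSucc i.succ) := by
      rw [Perm.mclosure_swap_castSucc_succ]; trivial
    induction hg using Submonoid.closure_induction with
    | mem x hx =>
      obtain ⟨i, rfl⟩ := hx
      exact fun ρ hρ => h ρ hρ i
    | one => simp
    | mul x y _ _ hx hy =>
      intro ρ hρ
      rw [mul_assoc]
      exact hx _ (hy _ hρ)

theorem gladiatorChain_irreducible (hp : ∀ i, 0 < p i) : IsIrreducibleChain (gladiatorChain p) :=
  fun _ hT h π => forall_mem_of_exchangeAt_mem hT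
    (fun ρ hρ k => h ρ hρ _ (gladiatorChain_exchangeAt_pos hp k ρ)) π

end Gladiator

/-! ### The next stronger gladiator below `c` -/

section Excess

/-- `a` is the best ranked member of `A` among those ranked below `c` in `π`. -/
def IsNextBelow {n : ℕ} (A : Finset (Fin n)) (c : Fin n) (π : Perm (Fin n)) (a : Fin n) : Prop :=
  a ∈ A ∧ π c < π a ∧ ∀ i ∈ A, π c < π i → π a ≤ π i

variable {n : ℕ} {p : Fin n → ℝ} {A : Finset (Fin n)} {c : Fin n}

theorem exists_isNextBelow {π : Perm (Fin n)} {i : Fin n} (hi : i ∈ A) (h : π c < π i) :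
    ∃ a, IsNextBelow A c π a := by
  obtain ⟨a, ha, hmin⟩ := exists_min_image (A.filter fun i => π c < π i) π ⟨i, by simp [hi, h]⟩
  simp only [mem_filter] at ha hmin
  exact ⟨a, ha.1, ha.2, fun i hi h => hmin i ⟨hi, h⟩⟩

theorem IsNextBelow.unique {π : Perm (Fin n)} {a b : Fin n} (ha : IsNextBelow A c π a)
    (hb : IsNextBelow A c π b) : a = b :=
  π.injective (le_antisymm (ha.2.2 b hb.1 hb.2.1) (hb.2.2 a ha.1 ha.2.1))

open Classical in
/-- The best ranked member of `A` below `c`, or `c` itself if there is none. -/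
noncomputable def nextBelow {n : ℕ} (A : Finset (Fin n)) (c : Fin n) (π : Perm (Fin n)) : Fin n :=
  if h : ∃ a, IsNextBelow A c π a then h.choose else c

theorem isNextBelow_nextBelow {π : Perm (Fin n)} {i : Fin n} (hi : i ∈ A) (h : π c < π i) :
    IsNextBelow A c π (nextBelow A c π) := by
  have := exists_isNextBelow hi h
  rw [nextBelow, dif_pos this]
  exact this.choose_spec

theorem IsNextBelow.mul_swap (hc : c ∉ A) {π : Perm (Fin n)} {a i : Fin n}
    (ha : IsNextBelow A c π a) (hi : i ∈ A) :
    IsNextBelow A c (π * swap a i) i := by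
  have hca : c ≠ a := fun e => hc (e ▸ ha.1)
  have hci : c ≠ i := fun e => hc (e ▸ hi)
  have e1 : (π * swap a i) c = π c := by
    rw [Perm.mul_apply, swap_apply_of_ne_of_ne hca hci]
  have e2 : (π * swap a i) i = π a := by simp
  refine ⟨hi, by rw [e1, e2]; exact ha.2.1, fun l hl hlt => ?_⟩
  rw [e1] at hlt
  rw [e2]
  refine ha.2.2 (swap a i l) ?_ hlt
  by_cases h1 : l = a
  · rw [h1, swap_apply_left]; exact hi
  by_cases h2 : l = i
  · rw [h2, swap_apply_right]; exact ha.1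
  rwa [swap_apply_of_ne_of_ne h1 h2]

/-- Two rankings with the same result of exchanging `c` with the next member of `A` agree. -/
theorem IsNextBelow.eq_of_mul_swap_eq (hc : c ∉ A) {π ρ : Perm (Fin n)} {a b : Fin n}
    (ha : IsNextBelow A c π a) (hb : IsNextBelow A c ρ b)
    (h : π * swap c a = ρ * swap c b) : a = b := by
  -- In the common image, `a` and `b` are each the worst ranked member of `A` above `c`, which
  -- determines them.
  wlog hlt : (π * swap c a) a ≤ (π * swap c a) b generalizing π ρ a b
  · exact (this hb ha h.symm (by rw [← h]; exact (not_le.1 hlt).le)).symm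
  by_contra hab
  have hcb : b ≠ c := fun e => hc (e ▸ hb.1)
  have e1 : (π * swap c a) b = π b := by
    rw [Perm.mul_apply, swap_apply_of_ne_of_ne hcb (Ne.symm hab)]
  have e2 : (π * swap c a) a = π c := by simp
  have e3 : (π * swap c a) c = π a := by simp
  have e4 : (π * swap c a) c = ρ b := by rw [h]; simp
  have e5 : (π * swap c a) b = ρ c := by rw [h]; simp
  rw [e2, e1] at hlt
  have h1 : π c < π b := lt_of_le_of_ne hlt (π.injective.ne hcb.symm)
  have h2 := ha.2.2 b hb.1 h1
  rw [← e3, e4, ← e1, e5] at h2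
  exact absurd hb.2.1 (not_lt.2 h2)

/-! ### Weight inequalities -/

/-- The factors of the weight that belong to three given gladiators. -/
theorem rankingWeight_split_three (hp : ∀ i, 0 < p i) (π : Perm (Fin n)) {x y z : Fin n}
    (hxy : x ≠ y) (hxz : x ≠ z) (hyz : y ≠ z) :
    ∃ R, 0 < R ∧ ∀ ρ : Perm (Fin n), (∀ i, i ≠ x → i ≠ y → i ≠ z → ρ i = π i) →
      rankingWeight p ρ =
        R * (p x ^ ((ρ x).rev : ℕ) * p y ^ ((ρ y).rev : ℕ) * p z ^ ((ρ z).rev : ℕ)) := by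
  have hy : y ∈ univ.erase x := by simp [hxy.symm]
  have hz : z ∈ (univ.erase x).erase y := by simp [hxz.symm, hyz.symm]
  refine ⟨∏ i ∈ ((univ.erase x).erase y).erase z, p i ^ ((π i).rev : ℕ),
    Finset.prod_pos fun i _ => pow_pos (hp i) _, fun ρ h => ?_⟩
  rw [rankingWeight, ← mul_prod_erase univ _ (mem_univ x), ← mul_prod_erase _ _ hy,
    ← mul_prod_erase _ _ hz, Finset.prod_congr rfl (g := fun i => p i ^ ((π i).rev : ℕ))]
  · ring
  · intro i hi
    simp only [mem_erase] at hi
    rw [h i hi.2.2.1 hi.2.1 hi.1]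

theorem pow_mul_pow_le_of_le {c a : ℝ} (hc : 0 < c) (hca : c ≤ a) {f g : ℕ} (hgf : g < f) :
    c ^ f * a ^ (g + 1) ≤ c ^ (g + 1) * a ^ f := by
  obtain ⟨d, rfl⟩ := Nat.exists_eq_add_of_le (show g + 1 ≤ f from hgf)
  have h := pow_le_pow_left₀ hc.le hca d
  have ha := hc.trans_le hca
  calc c ^ (g + 1 + d) * a ^ (g + 1) = c ^ (g + 1) * a ^ (g + 1) * c ^ d := by ring
    _ ≤ c ^ (g + 1) * a ^ (g + 1) * a ^ d := by gcongr
    _ = _ := by ring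

/-- With `d = g - e`, the difference of the sides is `(a * b) ^ e * (a ^ d - b ^ d) * (a - b)`. -/
theorem pow_rearrangement {a b : ℝ} (ha : 0 < a) (hb : 0 < b) {g e : ℕ} (heg : e ≤ g) :
    a ^ g * b ^ (e + 1) + b ^ g * a ^ (e + 1) ≤ a ^ (g + 1) * b ^ e + b ^ (g + 1) * a ^ e := by
  obtain ⟨d, rfl⟩ := Nat.exists_eq_add_of_le heg
  have h : 0 ≤ (a ^ d - b ^ d) * (a - b) := by
    rcases le_total a b with h | h
    · exact mul_nonneg_of_nonpos_of_nonpos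
        (sub_nonpos.2 (pow_le_pow_left₀ ha.le h d)) (sub_nonpos.2 h)
    · exact mul_nonneg (sub_nonneg.2 (pow_le_pow_left₀ hb.le h d)) (sub_nonneg.2 h)
  have h' := mul_nonneg (mul_pos (pow_pos ha e) (pow_pos hb e)).le h
  rw [← sub_nonneg]
  refine h'.trans_eq ?_
  ring

/-- Here `f > g ≥ e` are the exponents at the ranks of `c`, `a`, `b`. Rearrangement shifts the extra
factor from exponent `e` to `g`; then each term gains by giving the larger exponent to the stronger
gladiator. -/
theorem pow_exchange_le {c a b : ℝ} (hc : 0 < c) (hca : c ≤ a) (hcb : c ≤ b) {f g e : ℕ}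
    (heg : e ≤ g) (hgf : g < f) :
    c ^ f * (a ^ g * b ^ (e + 1) + b ^ g * a ^ (e + 1)) ≤
      c ^ (g + 1) * (a ^ f * b ^ e + b ^ f * a ^ e) := by
  have ha := hc.trans_le hca
  have hb := hc.trans_le hcb
  calc c ^ f * (a ^ g * b ^ (e + 1) + b ^ g * a ^ (e + 1))
      ≤ c ^ f * (a ^ (g + 1) * b ^ e + b ^ (g + 1) * a ^ e) :=
        mul_le_mul_of_nonneg_left (pow_rearrangement ha hb heg) (pow_pos hc f).le
    _ = c ^ f * a ^ (g + 1) * b ^ e + c ^ f * b ^ (g + 1) * a ^ e := by ring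
    _ ≤ c ^ (g + 1) * a ^ f * b ^ e + c ^ (g + 1) * b ^ f * a ^ e :=
        add_le_add
          (mul_le_mul_of_nonneg_right (pow_mul_pow_le_of_le hc hca hgf) (pow_pos hb e).le)
          (mul_le_mul_of_nonneg_right (pow_mul_pow_le_of_le hc hcb hgf) (pow_pos ha e).le)
    _ = _ := by ring

theorem rankingWeight_mul_le (hp : ∀ i, 0 < p i) {π : Perm (Fin n)} {c a : Fin n}
    (hca : p c ≤ p a) (h : π c < π a) :
    rankingWeight p π * p a ≤ rankingWeight p (π * swap c a) * p c := by
  obtain ⟨R, hR, h1, h2⟩ := rankingWeight_split_two p π (show c ≠ a from fun e => h.ne (by rw [e])) hp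
  rw [h1, h2]
  have := mul_le_mul_of_nonneg_left
    (pow_mul_pow_le_of_le (hp c) hca (Fin.lt_def.1 (Fin.rev_lt_rev.2 h))) hR.le
  rw [pow_succ, pow_succ] at this
  linarith

theorem rankingWeight_mul_add_le (hp : ∀ i, 0 < p i) {π : Perm (Fin n)} {c a b : Fin n}
    (hca : p c ≤ p a) (hcb : p c ≤ p b) (h : π c < π a) (h' : π a < π b) :
    rankingWeight p π * p b + rankingWeight p (π * swap a b) * p a ≤
      rankingWeight p (π * swap c a) * p c + rankingWeight p (π * swap a b * swap c b) * p c := by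
  have nca : c ≠ a := fun e => h.ne (by rw [e])
  have ncb : c ≠ b := fun e => (h.trans h').ne (by rw [e])
  have nab : a ≠ b := fun e => h'.ne (by rw [e])
  obtain ⟨R, hR, H⟩ := rankingWeight_split_three hp π nca ncb nab
  have key := mul_le_mul_of_nonneg_left (pow_exchange_le (hp c) hca hcb
    (Fin.lt_def.1 (Fin.rev_lt_rev.2 h')).le (Fin.lt_def.1 (Fin.rev_lt_rev.2 h))) hR.le
  rw [H π (fun _ _ _ _ => rfl),
    H (π * swap a b) (fun i _ h2 h3 => by rw [Perm.mul_apply, swap_apply_of_ne_of_ne h2 h3]),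
    H (π * swap c a) (fun i h1 h2 _ => by rw [Perm.mul_apply, swap_apply_of_ne_of_ne h1 h2]),
    H (π * swap a b * swap c b) (fun i h1 h2 h3 => by
      rw [Perm.mul_apply, Perm.mul_apply, swap_apply_of_ne_of_ne h1 h3,
        swap_apply_of_ne_of_ne h2 h3])]
  simp only [Perm.mul_apply, swap_apply_left, swap_apply_right,
    swap_apply_of_ne_of_ne nca ncb, swap_apply_of_ne_of_ne ncb.symm nab.symm,
    swap_apply_of_ne_of_ne nca.symm nab]
  simp only [pow_succ] at key
  linarith

/-! ### The involution and the injection on pairs -/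

/-- The pairs of a ranking and a member of `A` that it places below `c`. -/
def belowPairs {n : ℕ} (A : Finset (Fin n)) (c : Fin n) : Finset (Perm (Fin n) × Fin n) :=
  univ.filter fun x => x.2 ∈ A ∧ x.1 c < x.1 x.2

/-- Exchange the selected gladiator with the next member of `A` below `c`. -/
noncomputable def exchangeWithNext {n : ℕ} (A : Finset (Fin n)) (c : Fin n) (x : Perm (Fin n) × Fin n) :
    Perm (Fin n) × Fin n :=
  (x.1 * swap (nextBelow A c x.1) x.2, nextBelow A c x.1)

/-- Exchange `c` with the next member `a` of `A` below it, selecting `c` in place of `a`. -/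
noncomputable def passNext {n : ℕ} (A : Finset (Fin n)) (c : Fin n) (x : Perm (Fin n) × Fin n) :
    Perm (Fin n) × Fin n :=
  (x.1 * swap c (nextBelow A c x.1), if x.2 = nextBelow A c x.1 then c else x.2)

theorem mem_belowPairs {x : Perm (Fin n) × Fin n} :
    x ∈ belowPairs A c ↔ x.2 ∈ A ∧ x.1 c < x.1 x.2 := by
  simp [belowPairs]

theorem nextBelow_exchangeWithNext (hc : c ∉ A) {x : Perm (Fin n) × Fin n}
    (hx : x ∈ belowPairs A c) : nextBelow A c (exchangeWithNext A c x).1 = x.2 := by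
  rw [mem_belowPairs] at hx
  have h := (isNextBelow_nextBelow hx.1 hx.2).mul_swap hc hx.1
  exact (isNextBelow_nextBelow h.1 h.2.1).unique h

theorem exchangeWithNext_mem (hc : c ∉ A) {x : Perm (Fin n) × Fin n}
    (hx : x ∈ belowPairs A c) : exchangeWithNext A c x ∈ belowPairs A c := by
  rw [mem_belowPairs] at hx ⊢
  have h := isNextBelow_nextBelow hx.1 hx.2
  refine ⟨h.1, ?_⟩
  have hca : c ≠ nextBelow A c x.1 := fun e => hc (e ▸ h.1)
  have hci : c ≠ x.2 := fun e => hc (e ▸ hx.1)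
  simp only [exchangeWithNext, Perm.mul_apply, swap_apply_left, swap_apply_of_ne_of_ne hca hci]
  exact hx.2

theorem exchangeWithNext_exchangeWithNext (hc : c ∉ A) {x : Perm (Fin n) × Fin n}
    (hx : x ∈ belowPairs A c) : exchangeWithNext A c (exchangeWithNext A c x) = x := by
  have h := nextBelow_exchangeWithNext hc hx
  rw [exchangeWithNext, h]
  ext1
  · simp only [exchangeWithNext]
    rw [swap_comm x.2, mul_assoc, swap_mul_self, mul_one]
  · rfl

/-- The new ranking determines the next member, hence the old ranking; the selection `c` marks
exactly the case where that member was selected. -/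
theorem passNext_injOn (hc : c ∉ A) : Set.InjOn (passNext A c) (belowPairs A c) := by
  rintro ⟨π, i⟩ hx ⟨ρ, j⟩ hy h
  rw [mem_coe, mem_belowPairs] at hx hy
  have ha := isNextBelow_nextBelow hx.1 hx.2
  have hb := isNextBelow_nextBelow hy.1 hy.2
  simp only [passNext, Prod.mk.injEq] at h ha hb hx hy
  have hab := ha.eq_of_mul_swap_eq hc hb h.1
  obtain ⟨h1, h2⟩ := h
  rw [hab] at h1 h2
  have hic : i ≠ c := fun e => hc (e ▸ hx.1)
  have hjc : j ≠ c := fun e => hc (e ▸ hy.1)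
  refine Prod.ext (mul_right_cancel h1) ?_
  show i = j
  split_ifs at h2 with e1 e2 e2
  · rw [e1, e2]
  · exact absurd h2.symm hjc
  · exact absurd h2 hic
  · exact h2

theorem passNext_mem (hc : c ∉ A) {x : Perm (Fin n) × Fin n} (hx : x ∈ belowPairs A c) :
    passNext A c x ∈ belowPairs A c ∪ univ.filter fun y => y.2 = c := by
  rw [mem_belowPairs] at hx
  have ha := isNextBelow_nextBelow hx.1 hx.2
  rw [mem_union, mem_belowPairs, mem_filter]
  by_cases h : x.2 = nextBelow A c x.1
  · right
    simp [passNext, h]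
  · left
    have hic : x.2 ≠ c := fun e => hc (e ▸ hx.1)
    simp only [passNext, if_neg h, Perm.mul_apply, swap_apply_left, swap_apply_of_ne_of_ne hic h]
    exact ⟨hx.1, lt_of_le_of_ne (ha.2.2 _ hx.1 hx.2) (x.1.injective.ne (Ne.symm h))⟩

theorem rankingWeight_pair_le (hp : ∀ i, 0 < p i) (hA : ∀ i ∈ A, p c ≤ p i) (hc : c ∉ A)
    {x : Perm (Fin n) × Fin n} (hx : x ∈ belowPairs A c) :
    rankingWeight p x.1 * p x.2 +
        rankingWeight p (exchangeWithNext A c x).1 * p (exchangeWithNext A c x).2 ≤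
      rankingWeight p (passNext A c x).1 * p c +
        rankingWeight p (passNext A c (exchangeWithNext A c x)).1 * p c := by
  have hnext := nextBelow_exchangeWithNext hc hx
  rw [mem_belowPairs] at hx
  have ha := isNextBelow_nextBelow hx.1 hx.2
  simp only [passNext, hnext]
  simp only [exchangeWithNext]
  by_cases h : nextBelow A c x.1 = x.2
  -- A fixed point of the involution: the two-gladiator inequality is counted twice.
  · rw [h, swap_self]
    have := rankingWeight_mul_le hp (hA _ hx.1) hx.2
    exact add_le_add this this
  · exact rankingWeight_mul_add_le hp (hA _ ha.1) (hA _ hx.1) ha.2.1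
      (lt_of_le_of_ne (ha.2.2 _ hx.1 hx.2) (x.1.injective.ne h))

theorem sum_belowPairs_le (hp : ∀ i, 0 < p i) (hA : ∀ i ∈ A, p c ≤ p i) (hc : c ∉ A) :
    ∑ x ∈ belowPairs A c, rankingWeight p x.1 * p x.2 ≤
      ∑ x ∈ belowPairs A c, rankingWeight p x.1 * p c + ∑ π, rankingWeight p π * p c := by
  have reindex : ∀ F : Perm (Fin n) × Fin n → ℝ,
      ∑ x ∈ belowPairs A c, F (exchangeWithNext A c x) = ∑ x ∈ belowPairs A c, F x := fun F =>
    Finset.sum_nbij' (exchangeWithNext A c) (exchangeWithNext A c)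
      (fun _ h => exchangeWithNext_mem hc h) (fun _ h => exchangeWithNext_mem hc h)
      (fun _ h => exchangeWithNext_exchangeWithNext hc h)
      (fun _ h => exchangeWithNext_exchangeWithNext hc h) (fun _ _ => rfl)
  -- After reindexing by the involution, both sides are twice the desired sums.
  have h1 := Finset.sum_le_sum fun x hx => rankingWeight_pair_le hp hA hc (x := x) hx
  rw [Finset.sum_add_distrib, Finset.sum_add_distrib,
    reindex fun x => rankingWeight p x.1 * p x.2,
    reindex fun x => rankingWeight p (passNext A c x).1 * p c] at h1
  have hdisj : Disjoint (belowPairs A c) (univ.filter fun y => y.2 = c) := by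
    rw [Finset.disjoint_left]
    intro x hx hx'
    rw [mem_belowPairs] at hx
    exact hc ((mem_filter.1 hx').2 ▸ hx.1)
  have h2 : ∑ x ∈ belowPairs A c, rankingWeight p (passNext A c x).1 * p c ≤
      ∑ x ∈ belowPairs A c ∪ univ.filter (fun y => y.2 = c), rankingWeight p x.1 * p c := by
    rw [← Finset.sum_image (f := fun x => rankingWeight p x.1 * p c) (passNext_injOn hc)]
    refine Finset.sum_le_sum_of_subset_of_nonneg ?_ fun x _ _ =>
      (mul_pos (rankingWeight_pos hp _) (hp c)).le
    exact image_subset_iff.2 fun x hx => passNext_mem hc hx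
  have h3 : ∑ x ∈ univ.filter (fun y : Perm (Fin n) × Fin n => y.2 = c),
      rankingWeight p x.1 * p c = ∑ π, rankingWeight p π * p c := by
    rw [Finset.sum_filter, Fintype.sum_prod_type]
    simp
  rw [Finset.sum_union hdisj, h3] at h2
  linarith

theorem sum_rankingWeight_mul_excessBelow_le (hp : ∀ i, 0 < p i) (c : Fin n) :
    ∑ π, rankingWeight p π * excessBelow p c π ≤ p c * ∑ π, rankingWeight p π := by
  -- The strict inequality keeps `c` out of `A`; ties contribute no excess.
  have h := sum_belowPairs_le (A := univ.filter fun i => p c < p i) (c := c) hp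
    (fun i hi => (mem_filter.1 hi).2.le) (by simp)
  have e : ∑ π, rankingWeight p π * excessBelow p c π =
      ∑ x ∈ belowPairs (univ.filter fun i => p c < p i) c,
        (rankingWeight p x.1 * p x.2 - rankingWeight p x.1 * p c) := by
    rw [belowPairs, Finset.sum_filter, Fintype.sum_prod_type]
    refine Finset.sum_congr rfl fun π _ => ?_
    rw [excessBelow, Finset.mul_sum, Finset.sum_filter]
    refine Finset.sum_congr rfl fun i _ => ?_
    by_cases h1 : π c < π i
    · by_cases h2 : p c < p i
      · simp only [h1, h2, if_true, mem_filter, mem_univ, and_self, max_eq_left (sub_pos.2 h2).le]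
        ring
      · simp [h1, h2, max_eq_right (sub_nonpos.2 (not_lt.1 h2))]
    · simp [h1]
  rw [e, Finset.sum_sub_distrib, mul_comm, Finset.sum_mul]
  linarith

end Excess

theorem corollary2 (n : ℕ) (p : Fin n → ℝ) (hp : ∀ i, 0 < p i) :
    (∃! μ : Equiv.Perm (Fin n) → ℝ, IsStationaryDistribution (gladiatorChain p) μ) ∧
    ∀ μ : Equiv.Perm (Fin n) → ℝ, IsStationaryDistribution (gladiatorChain p) μ →
      ∀ j : Fin n, expectation μ (excessBelow p j) ≤ p j := by
  have uniq : ∀ μ, IsStationaryDistribution (gladiatorChain p) μ →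
      μ = fun π => rankingWeight p π / ∑ σ, rankingWeight p σ := fun μ hμ =>
    hμ.eq_normalize (rankingWeight_pos hp) (gladiatorChain_nonneg hp) (sum_gladiatorChain hp)
      (gladiatorChain_balance hp) (gladiatorChain_irreducible hp)
  refine ⟨⟨_, isStationaryDistribution_normalize (rankingWeight_pos hp) (sum_gladiatorChain hp)
    (gladiatorChain_balance hp), uniq⟩, fun μ hμ j => ?_⟩
  have hZ : 0 < ∑ σ, rankingWeight p σ :=
    Finset.sum_pos (fun σ _ => rankingWeight_pos hp σ) univ_nonempty
  rw [uniq μ hμ, expectation]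
  simp_rw [div_mul_eq_mul_div]
  rw [← Finset.sum_div, div_le_iff₀ hZ]
  exact sum_rankingWeight_mul_excessBelow_le hp j
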